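/- Notation. Let $\mathrm I=(0,\infty)\times(0,\infty)$ (variables $(t,x)$), $\mathrm{II}=\{(\tau,\xi):0<\tau<\xi\}$, and $\Phi:\mathrm I\to\mathrm{II}$, $\Phi(t,x)=(t,t+x)$. Let $u_0:[0,\infty)\to[0,\infty)$ be right continuous and of finite pointwise variation on $[0,a]$ for every $a>0$. All functions are Lebesgue measurable; "locally bounded" means bounded on compact subsets of the (open) domain. *Integral solution.* A locally bounded $\hat u:\mathrm{II}\to[0,\infty)$, defined everywhere, such that (i) for every $\tau>0$ the limit $\hat u(\tau,\tau):=\lim_{\xi\to\tau^+}\hat u(\tau,\xi)\in[0,\infty)$ exists, and (ii) for every $(\tau,\xi)\in\mathrm{II}$ $$\hat u(\tau,\xi)=u_0(\xi)+\int_0^\tau 1_{(s,\hat u(s,s)+s)}(\xi)\,ds .\qquad (\ast)$$ *Distributional solution* of $u_t=u_x+1_{(0,u(t,0))}(x)$, $u(0,\cdot)=u_0$. A nonnegative $u\in L^1_{\rm loc}(\mathrm I)$, defined everywhere, such that for every $t>0$ the limit $u(t,0):=\lim_{x\to0^+}u(t,x)\in[0,\infty)$ exists, and such that for every $\varphi\in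 C^1_c([0,\infty)\times(0,\infty))$ the function $u(\varphi_t-\varphi_x)$ is integrable on $\mathrm I$ and $$-\int_{\mathrm I}u(\varphi_t-\varphi_x)\,dt\,dx-\int_{\mathrm I}1_{(0,u(t,0))}(x)\,\varphi(t,x)\,dt\,dx-\int_0^\infty u_0(x)\varphi(0,x)\,dx=0 .$$ *Approximate limit.* A locally integrable $u$ has approximate limit $l$ at $z$ if the mean of $|u-l|$ over the disc of radius $r$ centred at $z$ tends to $0$ as $r\to0^+$; $l$ is then the value at $z$ of the precise representative of $u$. **Proposition.** (a) If $\hat u$ is an integral solution, then $u:=\hat u\circ\Phi$ is a distributional solution. (b) Conversely, let $u\in BV_{\rm loc}(\mathrm I)$ be a locally bounded distributional solution and let $\hat u:=u\circ\Phi^{-1}$. Then $\hat u$ satisfies (i), and it satisfies the integral equation in the following sense: 1. $(\ast)$ holds for almost every $(\tau,\xi)\in\mathrm{II}$; 2. for every $\tau>0$ and almost every $\xi>\tau$, $u$ has an approximate limit at $\Phi^{-1}(\tau,\xi)$ and it is equal to the right-hand side of $(\ast)$, that is, the precise representative satisfies the equation for every $\tau>0$ and almost every $\xi>\tau$; 3.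 consequently, if $\tau>0$ and if, for almost every $x>0$, $u(\tau,x)$ equals the approximate limit of $u$ at $(\tau,x)$ whenever that limit exists, then $(\ast)$ holds for this $\tau$ and almost every $\xi>\tau$. In particular, if $u$ is its precise representative, $(\ast)$ holds for every $\tau>0$ and almost every $\xi>\tau$. -/

import Mathlib

open Set Filter Topology MeasureTheory

noncomputable section

namespace Mancala

/-- The open first quadrant of the `(t, x)` plane. -/
def Iquad : Set (ℝ × ℝ) := {p | 0 < p.1 ∧ 0 < p.2}

/-- The open second octant `{(τ, ξ) : 0 < τ < ξ}`. -/
def IIoct : Set (ℝ × ℝ) := {p | 0 < p.1 ∧ p.1 < p.2}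

/-- The change of variables `(t, x) ↦ (τ, ξ) = (t, t + x)`, which maps `Iquad` onto `IIoct`. -/
def Phi (p : ℝ × ℝ) : ℝ × ℝ := (p.1, p.1 + p.2)

/-- The inverse change of variables `(τ, ξ) ↦ (t, x) = (τ, ξ - τ)`. -/
def PhiInv (p : ℝ × ℝ) : ℝ × ℝ := (p.1, p.2 - p.1)

/-- Admissible initial data: nonnegative right continuous functions on `[0, +∞)`
of finite pointwise variation on every `[0, a]`. Values on `(-∞, 0)` are irrelevant. -/
structure IsInitialDatum (u₀ : ℝ → ℝ) : Prop where
  bv : LocallyBoundedVariationOn u₀ (Ici 0)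
  right_cont : ∀ x, 0 ≤ x → ContinuousWithinAt u₀ (Ici x) x
  nonneg : ∀ x, 0 ≤ x → 0 ≤ u₀ x

/-- `v` is bounded on every compact subset of `Ω`. -/
def LocBoundedOn (v : ℝ × ℝ → ℝ) (Ω : Set (ℝ × ℝ)) : Prop :=
  ∀ K ⊆ Ω, IsCompact K → ∃ C : ℝ, ∀ p ∈ K, |v p| ≤ C

/-- The boundary value `u(t, 0) = lim_{x → 0⁺} u(t, x)`; it is only used for functions for
which this limit is part of the requirements. -/
def boundaryValue (u : ℝ × ℝ → ℝ) (t : ℝ) : ℝ :=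
  limUnder (𝓝[>] (0 : ℝ)) (fun x => u (t, x))

/-- The diagonal value `v(τ, τ) = lim_{ξ → τ⁺} v(τ, ξ)`; it is only used for functions for
which this limit is part of the requirements. -/
def diagValue (v : ℝ × ℝ → ℝ) (τ : ℝ) : ℝ :=
  limUnder (𝓝[>] τ) (fun ξ => v (τ, ξ))

/-- For every `τ > 0` the limit `v(τ, τ) = lim_{ξ → τ⁺} v(τ, ξ)` exists in `[0, +∞)`. -/
def HasDiagLimits (v : ℝ × ℝ → ℝ) : Prop :=
  ∀ τ, 0 < τ → ∃ l : ℝ, 0 ≤ l ∧ Tendsto (fun ξ => v (τ, ξ)) (𝓝[>] τ) (𝓝 l)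

/-- The right-hand side of the integral equation,
`u₀(ξ) + ∫_0^τ 1_{(s, v(s,s) + s)}(ξ) ds`, as a function of `(τ, ξ)`. -/
def integralRHS (u₀ : ℝ → ℝ) (v : ℝ × ℝ → ℝ) (p : ℝ × ℝ) : ℝ :=
  u₀ p.2 + ∫ s in (0 : ℝ)..p.1, (Ioo s (diagValue v s + s)).indicator (fun _ => (1 : ℝ)) p.2

/-- Integral solutions, as (Lebesgue measurable) functions on `IIoct`. -/
structure IsIntegralSolution (u₀ : ℝ → ℝ) (v : ℝ × ℝ → ℝ) : Prop where
  measurable : AEMeasurable v (volume.restrict IIoct)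
  nonneg : ∀ p ∈ IIoct, 0 ≤ v p
  bounded : LocBoundedOn v IIoct
  diag : HasDiagLimits v
  eqn : ∀ p ∈ IIoct, v p = integralRHS u₀ v p

/-- The partial derivative with respect to the first variable. -/
def pd₁ (φ : ℝ × ℝ → ℝ) (p : ℝ × ℝ) : ℝ := fderiv ℝ φ p (1, 0)

/-- The partial derivative with respect to the second variable. -/
def pd₂ (φ : ℝ × ℝ → ℝ) (p : ℝ × ℝ) : ℝ := fderiv ℝ φ p (0, 1)

/-- Test functions of class `C¹_c([0, +∞) × (0, +∞))`, given as `C¹` functions on the plane with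
compact support contained in `{x > 0}`: the elements of `C¹_c([0, +∞) × (0, +∞))` are exactly
the restrictions of these functions to `t ≥ 0`; no condition is imposed at `t = 0`. -/
structure IsTest (φ : ℝ × ℝ → ℝ) : Prop where
  smooth : ContDiff ℝ 1 φ
  compact : HasCompactSupport φ
  support : tsupport φ ⊆ {p | 0 < p.2}

/-- Distributional solutions of `u_t = u_x + 1_{(0, u(t,0))}(x)` with initial datum `u₀`.
The first component of the last field says that the first integral makes sense
(the other two always do). -/
structure IsDistributionalSolution (u₀ : ℝ → ℝ) (u : ℝ × ℝ → ℝ) : Prop where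
  nonneg : ∀ p ∈ Iquad, 0 ≤ u p
  locInt : LocallyIntegrableOn u Iquad
  boundary : ∀ t, 0 < t → ∃ l : ℝ, 0 ≤ l ∧ Tendsto (fun x => u (t, x)) (𝓝[>] (0 : ℝ)) (𝓝 l)
  weak : ∀ φ : ℝ × ℝ → ℝ, IsTest φ →
    IntegrableOn (fun p => u p * (pd₁ φ p - pd₂ φ p)) Iquad ∧
    (∫ p in Iquad, -(u p * (pd₁ φ p - pd₂ φ p)))
      - (∫ p in Iquad,
          (Ioo 0 (boundaryValue u p.1)).indicator (fun _ => (1 : ℝ)) p.2 * φ p)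
      - (∫ x in Ioi (0 : ℝ), u₀ x * φ (0, x)) = 0

/-- `u ∈ BV_loc(Ω)`: `u` is locally integrable on `Ω`, and the distributional gradient of `u` has
finite total variation on each compact subset of `Ω`, expressed by duality with compactly
supported `C¹` vector fields `(ψ₁, ψ₂)` of Euclidean length at most one. -/
structure IsBVLoc (u : ℝ × ℝ → ℝ) (Ω : Set (ℝ × ℝ)) : Prop where
  locInt : LocallyIntegrableOn u Ω
  variation : ∀ K ⊆ Ω, IsCompact K → ∃ C : ℝ, ∀ ψ₁ ψ₂ : ℝ × ℝ → ℝ,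
    ContDiff ℝ 1 ψ₁ → ContDiff ℝ 1 ψ₂ → tsupport ψ₁ ⊆ K → tsupport ψ₂ ⊆ K →
    (∀ p, ψ₁ p ^ 2 + ψ₂ p ^ 2 ≤ 1) →
    ∫ p in Ω, u p * (pd₁ ψ₁ p + pd₂ ψ₂ p) ≤ C

/-- The open Euclidean disc. -/
def disc (p : ℝ × ℝ) (r : ℝ) : Set (ℝ × ℝ) :=
  {q | (q.1 - p.1) ^ 2 + (q.2 - p.2) ^ 2 < r ^ 2}

/-- `l` is the approximate limit of `u` at `p`, i.e. the mean value of `|u - l|` on the disc of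
radius `r` around `p` tends to `0` as `r → 0⁺`. Where it exists, the approximate limit is the value
at `p` of the precise representative of `u`. -/
def HasApproxLimit (u : ℝ × ℝ → ℝ) (p : ℝ × ℝ) (l : ℝ) : Prop :=
  Tendsto (fun r : ℝ => ⨍ q in disc p r, |u q - l|) (𝓝[>] (0 : ℝ)) (𝓝 0)

/-- `u` takes at `p` the value of its precise representative, if `u` has an approximate limit
at `p` (no requirement otherwise). -/
def IsPreciseAt (u : ℝ × ℝ → ℝ) (p : ℝ × ℝ) : Prop :=
  ∀ l : ℝ, HasApproxLimit u p l → u p = l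

end Mancala

end

namespace Mancala

/-! In the coordinates (τ, ξ) = (t, t + x) the operator ∂_t - ∂_x becomes ∂_τ, so for each fixed ξ
the equation is an ODE in τ, and integrating it gives the right-hand side of (∗). The nonlinearity
enters only through the trace; once the trace is frozen as a given function β, the problem is
linear, with explicit solution `mild f β`.

Fubini along the lines ξ = const shows that `mild f β ∘ Phi` satisfies the weak equation with source
1_{(0, β(t))}(x), for measurable β and measurable locally bounded f (`mild_weak`). This yields (a).

For (b), let β be the trace of u. Then u and `mild f β ∘ Phi` satisfy the same linear weak identity,
so their difference annihilates every φ_t - φ_x. By duality this suffices: every η in C¹_c(I) has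
this form on I (`exists_isTest_pd_sub_eq`), hence the two agree almost everywhere
(`IsDistributionalSolution.ae_eq_mild`).

The passage to every τ rests on `mild` being 1-Lipschitz in τ uniformly in ξ: a Lebesgue point of
the single slice ξ ↦ `mild f β (τ, ξ)` is then a point of approximate limit in the plane
(`ae_hasApproxLimit`). -/

/-- The right-hand side of the integral equation, with a prescribed diagonal value `β`. -/
noncomputable def mild (f β : ℝ → ℝ) (p : ℝ × ℝ) : ℝ :=
  f p.2 + ∫ s in (0 : ℝ)..p.1, (Ioo s (β s + s)).indicator (fun _ => (1 : ℝ)) p.2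

/-! ### Measurability and bounds for the mild formula -/

theorem integralRHS_eq_mild (u₀ : ℝ → ℝ) (v : ℝ × ℝ → ℝ) :
    integralRHS u₀ v = mild u₀ (diagValue v) := rfl

/-- Allows the trace, which is measurable only up to a null set, to be replaced by a measurable β,
and u₀ by its extension by zero. -/
theorem mild_congr {f f' β β' : ℝ → ℝ} {p : ℝ × ℝ} (hf : f p.2 = f' p.2)
    (hβ : β =ᵐ[volume.restrict (Ioi 0)] β') (hp : 0 < p.1) : mild f β p = mild f' β' p := by
  unfold mild
  rw [hf]
  congr 1
  refine intervalIntegral.integral_congr_ae_restrict ?_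
  rw [uIoc_of_le hp.le]
  filter_upwards [ae_restrict_of_ae_restrict_of_subset Ioc_subset_Ioi_self hβ] with s hs
  rw [hs]

theorem measurable_strip {β : ℝ → ℝ} (hβ : Measurable β) :
    Measurable fun q : ℝ × ℝ => (Ioo q.1 (β q.1 + q.1)).indicator (fun _ => (1 : ℝ)) q.2 := by
  have hS : MeasurableSet {q : ℝ × ℝ | q.1 < q.2 ∧ q.2 < β q.1 + q.1} :=
    (measurableSet_lt measurable_fst measurable_snd).inter
      (measurableSet_lt measurable_snd ((hβ.comp measurable_fst).add measurable_fst))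
  exact (measurable_const (a := (1 : ℝ))).indicator hS

theorem abs_strip_le (β : ℝ → ℝ) (s ξ : ℝ) :
    |(Ioo s (β s + s)).indicator (fun _ => (1 : ℝ)) ξ| ≤ 1 := by
  by_cases h : ξ ∈ Ioo s (β s + s) <;> simp [h]

theorem measurable_mild {f β : ℝ → ℝ} (hf : Measurable f) (hβ : Measurable β) :
    Measurable (mild f β) := by
  have key : ∀ S : Set ((ℝ × ℝ) × ℝ), MeasurableSet S → Measurable fun p : ℝ × ℝ =>
      ∫ s, S.indicator
        (fun z => (Ioo z.2 (β z.2 + z.2)).indicator (fun _ => (1 : ℝ)) z.1.2) (p, s) := by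
    intro S hS
    refine (StronglyMeasurable.integral_prod_right' (f := S.indicator
        (fun z => (Ioo z.2 (β z.2 + z.2)).indicator (fun _ => (1 : ℝ)) z.1.2))
        (Measurable.stronglyMeasurable ?_)).measurable
    refine Measurable.indicator ?_ hS
    exact (measurable_strip hβ).comp (measurable_snd.prodMk (measurable_snd.comp measurable_fst))
  -- The two orientations of the integral from 0 to τ, each written as an integral over the whole
  -- line so that joint measurability applies.
  have h₁ := key {z | 0 < z.2 ∧ z.2 ≤ z.1.1} (by measurability)
  have h₂ := key {z | z.1.1 < z.2 ∧ z.2 ≤ 0} (by measurability)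
  refine (hf.comp measurable_snd).add ?_
  convert h₁.sub h₂ using 1
  ext p
  rw [intervalIntegral, ← integral_indicator measurableSet_Ioc,
    ← integral_indicator measurableSet_Ioc]
  rfl

/-- The integrand takes values in {0, 1}, and the modulus in τ does not depend on ξ. This uniformity
is what later transfers information from one slice to a planar neighbourhood. -/
theorem abs_mild_sub_mild_le {f β : ℝ → ℝ} (hβ : Measurable β) (τ τ' ξ : ℝ) :
    |mild f β (τ', ξ) - mild f β (τ, ξ)| ≤ |τ' - τ| := by
  have hi : ∀ a b : ℝ, IntervalIntegrable
      (fun s => (Ioo s (β s + s)).indicator (fun _ => (1 : ℝ)) ξ) volume a b := by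
    intro a b
    rw [intervalIntegrable_iff]
    refine IntegrableOn.of_bound (by simp) ?_ 1
      (ae_of_all _ fun s => by simpa using abs_strip_le β s ξ)
    exact ((measurable_strip hβ).comp (measurable_id.prodMk measurable_const)).aestronglyMeasurable
  simp only [mild, add_sub_add_left_eq_sub]
  rw [intervalIntegral.integral_interval_sub_left (hi _ _) (hi _ _)]
  have := intervalIntegral.norm_integral_le_of_norm_le_const (a := τ) (b := τ') (C := 1)
    (f := fun s => (Ioo s (β s + s)).indicator (fun _ => (1 : ℝ)) ξ)
    (fun s _ => by simpa using abs_strip_le β s ξ)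
  simpa using this

theorem abs_mild_le {f β : ℝ → ℝ} (hβ : Measurable β) (p : ℝ × ℝ) :
    |mild f β p| ≤ |f p.2| + |p.1| := by
  have h := abs_mild_sub_mild_le (f := f) hβ 0 p.1 p.2
  have h0 : mild f β (0, p.2) = f p.2 := by simp [mild]
  rw [h0, sub_zero] at h
  have := abs_add_le (mild f β p - f p.2) (f p.2)
  rw [sub_add_cancel] at this
  linarith

/-! ### Integration by parts along a characteristic -/

theorem integral_const_add_primitive_mul_deriv {g h : ℝ → ℝ} (hg : Measurable g)
    (hb : ∀ s, |g s| ≤ 1) (hh : ContDiff ℝ 1 h) (hc : HasCompactSupport h) (c : ℝ) :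
    ∫ τ in Ioi 0, (c + ∫ s in (0 : ℝ)..τ, g s) * deriv h τ =
      -(c * h 0) - ∫ s in Ioi 0, g s * h s := by
  have hd : Continuous (deriv h) := hh.continuous_deriv le_rfl
  have hdi : Integrable (deriv h) := hd.integrable_of_hasCompactSupport hc.deriv
  obtain ⟨R, hR0, hR⟩ : ∃ R, 0 < R ∧ ∀ τ, R < τ → deriv h τ = 0 := by
    obtain ⟨R, hR⟩ := hc.deriv.isCompact.isBounded.subset_closedBall (0 : ℝ)
    refine ⟨max R 1, by positivity, fun τ hτ => by_contra fun hne => ?_⟩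
    have := hR (subset_tsupport _ hne)
    rw [mem_closedBall_zero_iff, Real.norm_eq_abs] at this
    have := le_abs_self τ
    have := le_max_left R 1
    linarith
  obtain ⟨M, hM⟩ := hd.bounded_above_of_compact_support hc.deriv
  -- Since g is merely measurable, the integration by parts is a Fubini exchange for the kernel 1_{s
  -- < τ} h'(τ) g(s), which vanishes outside [0, R]² on the quadrant.
  have hk : Integrable (Function.uncurry fun τ s => (Ioi s).indicator (deriv h) τ * g s)
      ((volume.restrict (Ioi 0)).prod (volume.restrict (Ioi 0))) := by
    rw [Measure.prod_restrict]
    have hm : Measurable (Function.uncurry fun τ s : ℝ => (Ioi s).indicator (deriv h) τ * g s) := by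
      refine Measurable.mul ?_ (hg.comp measurable_snd)
      exact (hd.measurable.comp measurable_fst).indicator
        (measurableSet_lt measurable_snd measurable_fst)
    refine IntegrableOn.of_forall_sdiff_eq_zero (s := Icc 0 R ×ˢ Icc 0 R) ?_
      (measurableSet_Ioi.prod measurableSet_Ioi) ?_
    · refine IntegrableOn.of_bound (isCompact_Icc.prod isCompact_Icc).measure_lt_top
        hm.aestronglyMeasurable M (ae_of_all _ ?_)
      rintro ⟨τ, s⟩
      have h1 : ‖(Ioi s).indicator (deriv h) τ‖ ≤ M :=
        (norm_indicator_le_norm_self _ _).trans (hM τ)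
      calc ‖(Ioi s).indicator (deriv h) τ * g s‖ = ‖(Ioi s).indicator (deriv h) τ‖ * |g s| :=
            norm_mul _ _
        _ ≤ M * 1 := mul_le_mul h1 (hb s) (abs_nonneg _) ((norm_nonneg _).trans h1)
        _ = M := mul_one M
    · rintro ⟨τ, s⟩ ⟨⟨hτ, hs⟩, hn⟩
      simp only [mem_Ioi] at hτ hs
      by_cases hsτ : s < τ
      · have : R < τ := by
          by_contra hle
          exact hn ⟨⟨hτ.le, by linarith⟩, ⟨hs.le, by linarith⟩⟩
        simp [Function.uncurry, hR τ this, indicator]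
      · simp [Function.uncurry, hsτ]
  have e1 : ∀ τ ∈ Ioi (0 : ℝ), ∫ s in Ioi 0, (Ioi s).indicator (deriv h) τ * g s =
      (∫ s in (0 : ℝ)..τ, g s) * deriv h τ := by
    intro τ hτ
    have : ∀ s, (Ioi s).indicator (deriv h) τ * g s = (Iio τ).indicator g s * deriv h τ := by
      intro s
      by_cases hs : s < τ <;> simp [hs, mul_comm]
    simp_rw [this]
    rw [integral_mul_const, setIntegral_indicator measurableSet_Iio, Ioi_inter_Iio,
      intervalIntegral.integral_of_le (le_of_lt hτ), integral_Ioc_eq_integral_Ioo]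
  have e2 : ∀ s ∈ Ioi (0 : ℝ), ∫ τ in Ioi 0, (Ioi s).indicator (deriv h) τ * g s =
      -(g s * h s) := by
    intro s hs
    rw [integral_mul_const, setIntegral_indicator measurableSet_Ioi, Ioi_inter_Ioi,
      max_eq_right (le_of_lt hs), hc.integral_Ioi_deriv_eq hh]
    ring
  have hswap := integral_integral_swap hk
  have hint : IntegrableOn (fun τ => (∫ s in (0 : ℝ)..τ, g s) * deriv h τ) (Ioi 0) := by
    refine (integrableOn_congr_fun (fun τ hτ => ?_) measurableSet_Ioi).mp hk.integral_prod_left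
    exact e1 τ hτ
  rw [setIntegral_congr_fun measurableSet_Ioi e1, setIntegral_congr_fun measurableSet_Ioi e2,
    integral_neg] at hswap
  simp_rw [add_mul]
  rw [integral_add (hdi.integrableOn.const_mul c) hint, hswap, integral_const_mul,
    hc.integral_Ioi_deriv_eq hh]
  ring

/-! ### The shear and the weak form of the mild formula -/

theorem measurableSet_Iquad : MeasurableSet Iquad :=
  (measurableSet_lt measurable_const measurable_fst).inter
    (measurableSet_lt measurable_const measurable_snd)

theorem isOpen_Iquad : IsOpen Iquad :=
  (isOpen_lt continuous_const continuous_fst).inter (isOpen_lt continuous_const continuous_snd)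

theorem measurableSet_IIoct : MeasurableSet IIoct :=
  (measurableSet_lt measurable_const measurable_fst).inter
    (measurableSet_lt measurable_fst measurable_snd)

theorem Iquad_eq_prod : Iquad = Ioi (0 : ℝ) ×ˢ Ioi (0 : ℝ) := rfl

theorem volume_restrict_Iquad : (volume : Measure (ℝ × ℝ)).restrict Iquad =
    (volume.restrict (Ioi (0 : ℝ))).prod (volume.restrict (Ioi (0 : ℝ))) := by
  rw [Measure.prod_restrict, Iquad_eq_prod]; rfl

theorem PhiInv_Phi (p : ℝ × ℝ) : PhiInv (Phi p) = p := by simp [Phi, PhiInv]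

theorem preimage_Phi_IIoct : Phi ⁻¹' IIoct = Iquad := by
  ext p; simp [Phi, IIoct, Iquad]

theorem measurePreserving_Phi : MeasurePreserving Phi (volume : Measure (ℝ × ℝ)) volume :=
  measurePreserving_prod_add (volume : Measure ℝ) (volume : Measure ℝ)

theorem measurableEmbedding_Phi : MeasurableEmbedding Phi :=
  (MeasurableEquiv.shearAddRight ℝ).measurableEmbedding

/-- Boundedness on bounded intervals. -/
def LocallyBounded (f : ℝ → ℝ) : Prop := ∀ a : ℝ, ∃ C : ℝ, ∀ x : ℝ, |x| ≤ a → |f x| ≤ C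

theorem IsTest.continuous_pd_sub {φ : ℝ × ℝ → ℝ} (hφ : IsTest φ) :
    Continuous fun p => pd₁ φ p - pd₂ φ p := by
  have h := hφ.smooth.continuous_fderiv one_ne_zero
  exact (h.clm_apply continuous_const).sub (h.clm_apply continuous_const)

theorem pd_sub_eq_zero {φ : ℝ × ℝ → ℝ} {p : ℝ × ℝ} (hp : p ∉ tsupport φ) :
    pd₁ φ p - pd₂ φ p = 0 := by
  have : fderiv ℝ φ p = 0 := by
    by_contra h
    exact hp (support_fderiv_subset ℝ h)
  simp [pd₁, pd₂, this]

theorem hasDerivAt_comp_shear {φ : ℝ × ℝ → ℝ} (τ ξ : ℝ)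
    (hφ : DifferentiableAt ℝ φ (τ, ξ - τ)) :
    HasDerivAt (fun τ => φ (τ, ξ - τ)) (pd₁ φ (τ, ξ - τ) - pd₂ φ (τ, ξ - τ)) τ := by
  have hl : HasDerivAt (fun τ : ℝ => (τ, ξ - τ)) ((1 : ℝ), (-1 : ℝ)) τ :=
    (hasDerivAt_id τ).prodMk (by simpa using (hasDerivAt_id τ).const_sub ξ)
  have e : pd₁ φ (τ, ξ - τ) - pd₂ φ (τ, ξ - τ) = fderiv ℝ φ (τ, ξ - τ) (1, -1) := by
    simp [pd₁, pd₂, ← map_sub]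
  rw [e]
  exact hφ.hasFDerivAt.comp_hasDerivAt τ hl

theorem IsTest.exists_bound {φ : ℝ × ℝ → ℝ} (hφ : IsTest φ) :
    ∃ R, 0 < R ∧ ∀ p ∈ tsupport φ, |p.1| ≤ R ∧ |p.2| ≤ R := by
  obtain ⟨R, hR⟩ := hφ.compact.isCompact.isBounded.subset_closedBall (0 : ℝ × ℝ)
  refine ⟨max R 1, by positivity, fun p hp => ?_⟩
  have := hR hp
  rw [mem_closedBall_zero_iff, Prod.norm_def] at this
  exact ⟨((le_max_left _ _).trans this).trans (le_max_left _ _),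
    ((le_max_right _ _).trans this).trans (le_max_left _ _)⟩

theorem IsTest.integrableOn_mul {φ F G : ℝ × ℝ → ℝ} (hφ : IsTest φ) (hF : Measurable F)
    (hG : Continuous G) (hG0 : ∀ p ∉ tsupport φ, G p = 0)
    (hFb : ∃ C, ∀ p ∈ Iquad ∩ tsupport φ, |F p| ≤ C) :
    IntegrableOn (fun p => F p * G p) Iquad := by
  obtain ⟨C, hC⟩ := hFb
  obtain ⟨M, hM⟩ := hφ.compact.isCompact.exists_bound_of_continuousOn hG.continuousOn
  have hms : MeasurableSet (Iquad ∩ tsupport φ) :=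
    measurableSet_Iquad.inter (isClosed_tsupport φ).measurableSet
  refine IntegrableOn.of_forall_sdiff_eq_zero (s := Iquad ∩ tsupport φ) ?_ measurableSet_Iquad ?_
  · refine IntegrableOn.of_bound ((measure_mono inter_subset_right).trans_lt
      hφ.compact.isCompact.measure_lt_top) (hF.mul hG.measurable).aestronglyMeasurable (C * M) ?_
    filter_upwards [ae_restrict_mem hms] with p hp
    rw [norm_mul]
    exact mul_le_mul (hC p hp) (hM p hp.2) (norm_nonneg _) ((abs_nonneg _).trans (hC p hp))
  · rintro p ⟨hp, hn⟩
    rw [hG0 p fun h => hn ⟨hp, h⟩, mul_zero]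

theorem integrableOn_strip_mul {β : ℝ → ℝ} (hβ : Measurable β) {φ : ℝ × ℝ → ℝ}
    (hφ : IsTest φ) : IntegrableOn
      (fun p => (Ioo 0 (β p.1)).indicator (fun _ => (1 : ℝ)) p.2 * φ p) Iquad := by
  refine hφ.integrableOn_mul ?_ hφ.smooth.continuous (fun p hp => image_eq_zero_of_notMem_tsupport hp)
    ⟨1, fun p _ => by by_cases h : p.2 ∈ Ioo 0 (β p.1) <;> simp [h]⟩
  have hS : MeasurableSet {q : ℝ × ℝ | 0 < q.2 ∧ q.2 < β q.1} :=
    (measurableSet_lt measurable_const measurable_snd).inter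
      (measurableSet_lt measurable_snd (hβ.comp measurable_fst))
  exact (measurable_const (a := (1 : ℝ))).indicator hS

theorem LocallyBounded.mild_Phi {f β : ℝ → ℝ} (hfb : LocallyBounded f) (hβ : Measurable β) (R : ℝ) :
    ∃ C, ∀ p ∈ Iquad, |p.1| ≤ R → |p.2| ≤ R → |mild f β (Phi p)| ≤ C := by
  obtain ⟨C, hC⟩ := hfb (R + R)
  refine ⟨C + R, fun p hp h1 h2 => (abs_mild_le hβ _).trans (add_le_add (hC _ ?_) h1)⟩
  exact (abs_add_le _ _).trans (add_le_add h1 h2)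

theorem integrableOn_mild_mul {f β : ℝ → ℝ} (hf : Measurable f) (hfb : LocallyBounded f)
    (hβ : Measurable β) {φ : ℝ × ℝ → ℝ} (hφ : IsTest φ) :
    IntegrableOn (fun p => mild f β (Phi p) * (pd₁ φ p - pd₂ φ p)) Iquad := by
  refine hφ.integrableOn_mul ((measurable_mild hf hβ).comp measurePreserving_Phi.measurable)
    hφ.continuous_pd_sub (fun p hp => pd_sub_eq_zero hp) ?_
  obtain ⟨R, -, hR⟩ := hφ.exists_bound
  obtain ⟨C, hC⟩ := hfb.mild_Phi hβ R
  exact ⟨C, fun p hp => hC p hp.1 (hR p hp.2).1 (hR p hp.2).2⟩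

/-- The vanishing of F for ξ ≤ τ allows the octant, which is the image of the quadrant, to be
enlarged to the full quadrant, where both iterated integrals have constant limits. -/
theorem setIntegral_comp_Phi {F : ℝ × ℝ → ℝ}
    (hF : ∀ p, p.2 ≤ p.1 → F p = 0) (hFi : IntegrableOn (fun p => F (Phi p)) Iquad) :
    IntegrableOn F Iquad ∧
      ∫ p in Iquad, F (Phi p) = ∫ ξ in Ioi 0, ∫ τ in Ioi 0, F (τ, ξ) := by
  have hsub : IIoct ⊆ Iquad := fun p hp => ⟨hp.1, hp.1.trans hp.2⟩
  have h0 : ∀ p ∈ Iquad \ IIoct, F p = 0 := fun p hp =>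
    hF p (not_lt.mp fun h => hp.2 ⟨hp.1.1, h⟩)
  have hi : IntegrableOn F IIoct := by
    rw [← preimage_Phi_IIoct] at hFi
    exact (measurePreserving_Phi.integrableOn_comp_preimage measurableEmbedding_Phi).mp hFi
  have hiQ : IntegrableOn F Iquad := hi.of_forall_sdiff_eq_zero measurableSet_Iquad h0
  refine ⟨hiQ, ?_⟩
  have e := measurePreserving_Phi.setIntegral_preimage_emb measurableEmbedding_Phi F IIoct
  rw [preimage_Phi_IIoct] at e
  rw [e, ← setIntegral_eq_of_subset_of_forall_sdiff_eq_zero measurableSet_Iquad hsub h0,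
    volume_restrict_Iquad, integral_prod_symm]
  rwa [← volume_restrict_Iquad]

theorem mild_weak {f β : ℝ → ℝ} (hf : Measurable f) (hfb : LocallyBounded f)
    (hβ : Measurable β) {φ : ℝ × ℝ → ℝ} (hφ : IsTest φ) :
    (∫ p in Iquad, -(mild f β (Phi p) * (pd₁ φ p - pd₂ φ p)))
      - (∫ p in Iquad, (Ioo 0 (β p.1)).indicator (fun _ => (1 : ℝ)) p.2 * φ p)
      - (∫ x in Ioi (0 : ℝ), f x * φ (0, x)) = 0 := by
  -- The support of φ stays in x > 0, so in the sheared variables nothing is left on or below the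
  -- diagonal and no boundary term arises there.
  have hzero : ∀ p : ℝ × ℝ, p.2 ≤ p.1 → PhiInv p ∉ tsupport φ := fun p hp h =>
    absurd (hφ.support h) (not_lt.mpr (sub_nonpos.mpr hp))
  obtain ⟨hi₁, e₁⟩ := setIntegral_comp_Phi
    (F := fun p => mild f β p * (pd₁ φ (PhiInv p) - pd₂ φ (PhiInv p)))
    (fun p hp => by rw [pd_sub_eq_zero (hzero p hp), mul_zero])
    (by simpa only [PhiInv_Phi] using integrableOn_mild_mul hf hfb hβ hφ)
  have hstrip : ∀ p : ℝ × ℝ, (Ioo (Phi p).1 (β (Phi p).1 + (Phi p).1)).indicator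
      (fun _ => (1 : ℝ)) (Phi p).2 = (Ioo 0 (β p.1)).indicator (fun _ => (1 : ℝ)) p.2 := by
    intro p
    have : (Phi p).2 ∈ Ioo (Phi p).1 (β (Phi p).1 + (Phi p).1) ↔ p.2 ∈ Ioo 0 (β p.1) := by
      simp only [Phi, mem_Ioo]
      constructor <;> rintro ⟨h1, h2⟩ <;> constructor <;> linarith
    by_cases h : p.2 ∈ Ioo 0 (β p.1)
    · rw [indicator_of_mem h, indicator_of_mem (this.mpr h)]
    · rw [indicator_of_notMem h, indicator_of_notMem (mt this.mp h)]
  obtain ⟨hi₂, e₂⟩ := setIntegral_comp_Phi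
    (F := fun p => (Ioo p.1 (β p.1 + p.1)).indicator (fun _ => (1 : ℝ)) p.2 * φ (PhiInv p))
    (fun p hp => by rw [image_eq_zero_of_notMem_tsupport (hzero p hp), mul_zero])
    (by simpa only [PhiInv_Phi, hstrip] using integrableOn_strip_mul hβ hφ)
  simp only [PhiInv_Phi] at e₁ e₂
  simp only [hstrip] at e₂
  obtain ⟨R, hR0, hR⟩ := hφ.exists_bound
  have inner : ∀ ξ ∈ Ioi (0 : ℝ),
      ∫ τ in Ioi 0, mild f β (τ, ξ) * (pd₁ φ (PhiInv (τ, ξ)) - pd₂ φ (PhiInv (τ, ξ))) =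
        -(f ξ * φ (0, ξ)) - ∫ τ in Ioi 0,
          (Ioo τ (β τ + τ)).indicator (fun _ => (1 : ℝ)) ξ * φ (PhiInv (τ, ξ)) := by
    intro ξ _
    have hsm : ContDiff ℝ 1 fun τ : ℝ => φ (τ, ξ - τ) :=
      hφ.smooth.comp (contDiff_id.prodMk (contDiff_const.sub contDiff_id))
    have hcs : HasCompactSupport fun τ : ℝ => φ (τ, ξ - τ) := by
      refine HasCompactSupport.intro (isCompact_Icc (a := -R) (b := R)) fun τ hτ => ?_
      exact image_eq_zero_of_notMem_tsupport fun h => hτ (abs_le.mp (hR _ h).1)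
    have := integral_const_add_primitive_mul_deriv
      (g := fun s => (Ioo s (β s + s)).indicator (fun _ => (1 : ℝ)) ξ)
      ((measurable_strip hβ).comp (measurable_id.prodMk measurable_const))
      (fun s => abs_strip_le β s ξ) hsm hcs (f ξ)
    simp only [sub_zero] at this
    refine Eq.trans (integral_congr_ae (ae_of_all _ fun τ => ?_)) this
    simp only [mild]
    rw [(hasDerivAt_comp_shear τ ξ (hφ.smooth.differentiable one_ne_zero _)).deriv]
    rfl
  rw [integral_neg, e₁, e₂, setIntegral_congr_fun measurableSet_Ioi inner]
  have hfi : IntegrableOn (fun x => f x * φ (0, x)) (Ioi 0) := by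
    obtain ⟨C, hC⟩ := hfb R
    have hc : Continuous fun x : ℝ => φ (0, x) :=
      hφ.smooth.continuous.comp (continuous_const.prodMk continuous_id)
    obtain ⟨M, hM⟩ := hφ.smooth.continuous.bounded_above_of_compact_support hφ.compact
    refine IntegrableOn.of_forall_sdiff_eq_zero (s := Ioc 0 R) ?_ measurableSet_Ioi ?_
    · refine IntegrableOn.of_bound (by simp) (hf.mul hc.measurable).aestronglyMeasurable (C * M) ?_
      filter_upwards [ae_restrict_mem measurableSet_Ioc] with x hx
      have := hC x ((abs_of_pos hx.1).trans_le hx.2)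
      rw [norm_mul]
      exact mul_le_mul this (hM _) (norm_nonneg _) ((abs_nonneg _).trans this)
    · rintro x ⟨hx, hn⟩
      have h0 : φ (0, x) = 0 := image_eq_zero_of_notMem_tsupport fun h =>
        hn ⟨hx, (le_abs_self x).trans (hR _ h).2⟩
      rw [h0, mul_zero]
  have hgi : IntegrableOn (fun ξ => ∫ τ in Ioi (0 : ℝ),
      (Ioo τ (β τ + τ)).indicator (fun _ => (1 : ℝ)) ξ * φ (PhiInv (τ, ξ))) (Ioi 0) := by
    rw [IntegrableOn, volume_restrict_Iquad] at hi₂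
    exact hi₂.integral_prod_right
  erw [integral_sub hfi.neg hgi, integral_neg]
  ring

/-! ### Measurability of the trace -/

theorem tendsto_Ioo_smallSets : Tendsto (fun n : ℕ => Ioo (0 : ℝ) (1 / ((n : ℝ) + 1))) atTop
    (𝓝[>] (0 : ℝ)).smallSets := by
  rw [tendsto_smallSets_iff]
  intro t ht
  obtain ⟨u, hu, hut⟩ := mem_nhdsGT_iff_exists_Ioo_subset.mp ht
  filter_upwards [(tendsto_one_div_add_atTop_nhds_zero_nat (𝕜 := ℝ)).eventually
    (gt_mem_nhds hu)] with n hn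
  exact (Ioo_subset_Ioo_right hn.le).trans hut

/-- A limit of slices is not obviously measurable when u is only a.e. measurable. The trace is
recovered as the limit of averages over (0, 1/(n+1)) of a measurable representative, whose slices
agree a.e. with those of u for almost every t. -/
theorem aemeasurable_boundary {u : ℝ × ℝ → ℝ} {b : ℝ → ℝ}
    (hu : AEMeasurable u (volume.restrict Iquad))
    (hb : ∀ t, 0 < t → Tendsto (fun x => u (t, x)) (𝓝[>] (0 : ℝ)) (𝓝 (b t))) :
    AEMeasurable b (volume.restrict (Ioi 0)) := by
  have hae := hu.ae_eq_mk
  have hm := hu.measurable_mk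
  set w := hu.mk u
  rw [volume_restrict_Iquad] at hae
  refine aemeasurable_of_tendsto_metrizable_ae (f := fun (n : ℕ) t =>
    (∫ x in Ioo (0 : ℝ) (1 / ((n : ℝ) + 1)), w (t, x)) / (1 / ((n : ℝ) + 1))) atTop ?_ ?_
  · intro n
    exact ((hm.stronglyMeasurable.integral_prod_right').measurable.div_const _).aemeasurable
  · filter_upwards [Measure.ae_ae_of_ae_prod hae, ae_restrict_mem measurableSet_Ioi] with t ht ht0
    have hw : Tendsto (fun x => w (t, x)) (𝓝[>] (0 : ℝ) ⊓ ae volume) (𝓝 (b t)) := by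
      refine ((hb t ht0).mono_left inf_le_left).congr' ?_
      rw [ae_restrict_iff' measurableSet_Ioi] at ht
      filter_upwards [ht.filter_mono inf_le_right,
        (eventually_mem_nhdsWithin (a := (0 : ℝ)) (s := Ioi 0)).filter_mono inf_le_left]
        with x hx hx0 using hx hx0
    have h := hw.integral_sub_linear_isLittleO_ae
      (hm.comp (measurable_const.prodMk measurable_id)).stronglyMeasurable.stronglyMeasurableAtFilter
      (Measure.finiteAt_nhdsWithin _ _ _) tendsto_Ioo_smallSets
      (fun n : ℕ => 1 / ((n : ℝ) + 1)) (Eventually.of_forall fun n => by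
        have : (0 : ℝ) ≤ 1 / ((n : ℝ) + 1) := by positivity
        simp only [Real.volume_real_Ioo_of_le this, sub_zero])
    have h2 := h.tendsto_div_nhds_zero.add_const (b t)
    rw [zero_add] at h2
    refine h2.congr fun n => ?_
    have : (0 : ℝ) < 1 / ((n : ℝ) + 1) := by positivity
    rw [sub_div, smul_eq_mul, mul_div_cancel_left₀ _ this.ne', sub_add_cancel]

/-! ### Regularity of the initial datum -/

theorem IsInitialDatum.measurable_indicator {u₀ : ℝ → ℝ} (h : IsInitialDatum u₀) :
    Measurable ((Ici 0).indicator u₀) := by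
  obtain ⟨p, q, hp, hq, rfl⟩ := h.bv.exists_monotoneOn_sub_monotoneOn
  -- Precomposition with `max 0` extends a monotone function on the half-line to a monotone one on
  -- ℝ.
  have key : ∀ r : ℝ → ℝ, MonotoneOn r (Ici 0) → Measurable fun x => r (max 0 x) := fun r hr =>
    Monotone.measurable fun x y hxy => hr (mem_Ici.mpr (le_max_left _ _)) (mem_Ici.mpr (le_max_left _ _))
      (max_le_max_left _ hxy)
  have e : (Ici (0 : ℝ)).indicator (p - q) =
      (Ici 0).indicator ((fun x => p (max 0 x)) - fun x => q (max 0 x)) := by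
    refine indicator_congr fun x hx => ?_
    simp [max_eq_right (mem_Ici.mp hx)]
  rw [e]
  exact ((key p hp).sub (key q hq)).indicator measurableSet_Ici

theorem IsInitialDatum.locallyBounded_indicator {u₀ : ℝ → ℝ} (h : IsInitialDatum u₀) :
    LocallyBounded ((Ici 0).indicator u₀) := by
  intro a
  obtain ⟨p, q, hp, hq, rfl⟩ := h.bv.exists_monotoneOn_sub_monotoneOn
  have key : ∀ r : ℝ → ℝ, MonotoneOn r (Ici 0) → ∀ x, 0 ≤ x → x ≤ a → |r x| ≤ |r 0| + |r a| := by
    intro r hr x hx hxa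
    have h1 := hr (mem_Ici.mpr le_rfl) (mem_Ici.mpr hx) hx
    have h2 := hr (mem_Ici.mpr hx) (mem_Ici.mpr (hx.trans hxa)) hxa
    rw [abs_le]
    constructor
    · linarith [neg_abs_le (r 0), abs_nonneg (r a)]
    · linarith [le_abs_self (r a), abs_nonneg (r 0)]
  refine ⟨|p 0| + |p a| + (|q 0| + |q a|), fun x hx => ?_⟩
  by_cases h0 : 0 ≤ x
  · rw [indicator_of_mem (mem_Ici.mpr h0)]
    have hxa := (le_abs_self x).trans hx
    exact (abs_sub _ _).trans (add_le_add (key p hp x h0 hxa) (key q hq x h0 hxa))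
  · rw [indicator_of_notMem (by simpa using h0), abs_zero]
    positivity

theorem tendsto_const_add_nhdsGT (t : ℝ) : Tendsto (fun x => t + x) (𝓝[>] (0 : ℝ)) (𝓝[>] t) := by
  refine tendsto_nhdsWithin_iff.mpr ⟨?_, ?_⟩
  · have : Tendsto (fun x : ℝ => t + x) (𝓝 0) (𝓝 (t + 0)) := tendsto_const_nhds.add tendsto_id
    rw [add_zero] at this
    exact this.mono_left nhdsWithin_le_nhds
  · filter_upwards [self_mem_nhdsWithin] with x hx
    simpa using hx

theorem tendsto_sub_const_nhdsGT (t : ℝ) : Tendsto (fun ξ => ξ - t) (𝓝[>] t) (𝓝[>] (0 : ℝ)) := by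
  refine tendsto_nhdsWithin_iff.mpr ⟨?_, ?_⟩
  · have : Tendsto (fun x : ℝ => x - t) (𝓝 t) (𝓝 (t - t)) := tendsto_id.sub tendsto_const_nhds
    rw [sub_self] at this
    exact this.mono_left nhdsWithin_le_nhds
  · filter_upwards [self_mem_nhdsWithin] with x hx
    simpa using hx

theorem exists_measurable_boundaryValue {u : ℝ × ℝ → ℝ}
    (hu : AEMeasurable u (volume.restrict Iquad))
    (hb : ∀ t, 0 < t → ∃ l : ℝ, 0 ≤ l ∧ Tendsto (fun x => u (t, x)) (𝓝[>] (0 : ℝ)) (𝓝 l)) :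
    ∃ β : ℝ → ℝ, Measurable β ∧ boundaryValue u =ᵐ[volume.restrict (Ioi 0)] β := by
  have h : AEMeasurable (boundaryValue u) (volume.restrict (Ioi 0)) :=
    aemeasurable_boundary hu fun t ht => by
      obtain ⟨l, -, hl⟩ := hb t ht
      exact tendsto_nhds_limUnder ⟨l, hl⟩
  exact ⟨h.mk _, h.measurable_mk, h.ae_eq_mk⟩

theorem integral_strip_congr {b β : ℝ → ℝ} (h : b =ᵐ[volume.restrict (Ioi 0)] β)
    (φ : ℝ × ℝ → ℝ) :
    ∫ p in Iquad, (Ioo 0 (b p.1)).indicator (fun _ => (1 : ℝ)) p.2 * φ p =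
      ∫ p in Iquad, (Ioo 0 (β p.1)).indicator (fun _ => (1 : ℝ)) p.2 * φ p := by
  refine integral_congr_ae ?_
  rw [volume_restrict_Iquad]
  filter_upwards [Measure.quasiMeasurePreserving_fst.ae h] with p hp
  rw [hp]

theorem integral_initial_congr (u₀ : ℝ → ℝ) (φ : ℝ × ℝ → ℝ) :
    ∫ x in Ioi (0 : ℝ), u₀ x * φ (0, x) =
      ∫ x in Ioi (0 : ℝ), (Ici 0).indicator u₀ x * φ (0, x) :=
  setIntegral_congr_fun measurableSet_Ioi fun x hx => by
    simp only [indicator_of_mem (mem_Ici.mpr (le_of_lt (mem_Ioi.mp hx)))]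

theorem locallyIntegrableOn_mild_Phi {f β : ℝ → ℝ} (hf : Measurable f) (hfb : LocallyBounded f)
    (hβ : Measurable β) : LocallyIntegrableOn (fun p => mild f β (Phi p)) Iquad := by
  rw [locallyIntegrableOn_iff isOpen_Iquad.isLocallyClosed]
  intro K hK hKc
  obtain ⟨R, hR⟩ := hKc.isBounded.subset_closedBall (0 : ℝ × ℝ)
  obtain ⟨C, hC⟩ := hfb.mild_Phi hβ R
  refine IntegrableOn.of_bound hKc.measure_lt_top
    ((measurable_mild hf hβ).comp measurePreserving_Phi.measurable).aestronglyMeasurable C ?_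
  filter_upwards [ae_restrict_mem hKc.measurableSet] with p hp
  have := hR hp
  rw [mem_closedBall_zero_iff, Prod.norm_def] at this
  exact hC p (hK hp) ((le_max_left _ _).trans this) ((le_max_right _ _).trans this)

/-! ### Integral solutions are distributional solutions -/

theorem IsIntegralSolution.isDistributionalSolution {u₀ : ℝ → ℝ} (hu₀ : IsInitialDatum u₀)
    {v : ℝ × ℝ → ℝ} (hv : IsIntegralSolution u₀ v) :
    IsDistributionalSolution u₀ fun p => v (Phi p) := by
  have hmem : ∀ p ∈ Iquad, Phi p ∈ IIoct := fun p hp => by rwa [← mem_preimage, preimage_Phi_IIoct]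
  have hbd : ∀ t, 0 < t → ∃ l : ℝ, 0 ≤ l ∧
      Tendsto (fun x => v (Phi (t, x))) (𝓝[>] (0 : ℝ)) (𝓝 l) := fun t ht => by
    obtain ⟨l, hl0, hl⟩ := hv.diag t ht
    exact ⟨l, hl0, hl.comp (tendsto_const_add_nhdsGT t)⟩
  have hmp : MeasurePreserving Phi (volume.restrict Iquad) (volume.restrict IIoct) := by
    have := measurePreserving_Phi.restrict_preimage measurableSet_IIoct
    rwa [preimage_Phi_IIoct] at this
  obtain ⟨β, hβ, hbβ⟩ := exists_measurable_boundaryValue (u := fun p => v (Phi p))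
    (AEMeasurable.comp_quasiMeasurePreserving hv.measurable hmp.quasiMeasurePreserving) hbd
  have hdiag : diagValue v =ᵐ[volume.restrict (Ioi 0)] β := by
    filter_upwards [hbβ, ae_restrict_mem measurableSet_Ioi] with t ht ht0
    rw [← ht]
    obtain ⟨l, -, hl⟩ := hv.diag t ht0
    exact hl.limUnder_eq.trans (hl.comp (tendsto_const_add_nhdsGT t)).limUnder_eq.symm
  have hmild : ∀ p ∈ Iquad, v (Phi p) = mild ((Ici 0).indicator u₀) β (Phi p) := by
    intro p hp
    rw [hv.eqn _ (hmem p hp), integralRHS_eq_mild]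
    refine mild_congr ?_ hdiag hp.1
    rw [indicator_of_mem]
    exact (add_pos hp.1 hp.2).le
  have hf := hu₀.measurable_indicator
  have hfb := hu₀.locallyBounded_indicator
  refine ⟨fun p hp => hv.nonneg _ (hmem p hp), ?_, hbd, fun φ hφ => ⟨?_, ?_⟩⟩
  · refine (locallyIntegrableOn_mild_Phi hf hfb hβ).congr ?_
    filter_upwards [ae_restrict_mem measurableSet_Iquad] with p hp using (hmild p hp).symm
  · refine (integrableOn_congr_fun (fun p hp => ?_) measurableSet_Iquad).mpr
      (integrableOn_mild_mul hf hfb hβ hφ)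
    simp only [hmild p hp]
  · have e : ∫ p in Iquad, -(v (Phi p) * (pd₁ φ p - pd₂ φ p)) =
        ∫ p in Iquad, -(mild ((Ici 0).indicator u₀) β (Phi p) * (pd₁ φ p - pd₂ φ p)) :=
      setIntegral_congr_fun measurableSet_Iquad fun p hp => by simp only [hmild p hp]
    rw [e, integral_strip_congr hbβ, integral_initial_congr]
    exact mild_weak hf hfb hβ hφ

/-! ### The dual transport equation and uniqueness -/

theorem hasDerivAt_integral_Ioi {g : ℝ → ℝ} (hg : Continuous g) (hgi : Integrable g) (τ : ℝ) :
    HasDerivAt (fun τ => ∫ s in Ioi τ, g s) (-g τ) τ := by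
  have e : (fun τ => ∫ s in Ioi τ, g s) = fun τ => (∫ s in Ioi 0, g s) - ∫ s in (0 : ℝ)..τ, g s := by
    ext τ
    have := intervalIntegral.integral_interval_add_Ioi (a := 0) (b := τ)
      hgi.integrableOn hgi.integrableOn
    linarith
  rw [e]
  exact (intervalIntegral.integral_hasDerivAt_right (hgi.intervalIntegrable)
    (hg.stronglyMeasurableAtFilter _ _) hg.continuousAt).const_sub _

/-- The tail integral is the convolution in the second variable of the indicator of (-∞, 0) with a
compactly supported C¹ function, so it is jointly C¹. -/
theorem contDiff_integral_Ioi {G : ℝ → ℝ → ℝ} (hG : ContDiff ℝ 1 fun q : ℝ × ℝ => G q.1 q.2)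
    {R : ℝ} (hR : ∀ ξ s, R < |s| → G ξ s = 0) :
    ContDiff ℝ 1 fun q : ℝ × ℝ => ∫ s in Ioi q.2, G q.1 s := by
  have h := contDiffOn_convolution_right_with_param (μ := (volume : Measure ℝ)) (n := 1)
    (ContinuousLinearMap.mul ℝ ℝ) (f := (Iio (0 : ℝ)).indicator fun _ => (1 : ℝ)) (g := G)
    (s := (univ : Set ℝ)) (k := Icc (-R) R) isOpen_univ isCompact_Icc
    (fun ξ s _ hs => hR ξ s (not_le.mp fun h => hs (abs_le.mp h)))
    ((locallyIntegrable_const (1 : ℝ)).indicator measurableSet_Iio) hG.contDiffOn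
  rw [univ_prod_univ, contDiffOn_univ] at h
  have e : (fun q : ℝ × ℝ => ∫ s in Ioi q.2, G q.1 s) = fun q : ℝ × ℝ =>
      convolution ((Iio (0 : ℝ)).indicator fun _ => (1 : ℝ)) (G q.1)
        (ContinuousLinearMap.mul ℝ ℝ) volume q.2 := by
    ext q
    rw [convolution_eq_swap, ← integral_indicator measurableSet_Ioi]
    refine integral_congr_ae (ae_of_all _ fun s => ?_)
    by_cases hs : q.2 < s <;> simp [hs]
  rw [e]
  exact h

/-- Every test function supported in the open quadrant is `φ_t - φ_x` there, for a test function
`φ` that is unrestricted at `t = 0`. -/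
theorem exists_isTest_pd_sub_eq {η : ℝ × ℝ → ℝ} (hη : ContDiff ℝ 1 η) (hc : HasCompactSupport η)
    (hs : tsupport η ⊆ Iquad) : ∃ φ, IsTest φ ∧ ∀ p ∈ Iquad, pd₁ φ p - pd₂ φ p = η p := by
  obtain ⟨R, hR⟩ := hc.isCompact.isBounded.subset_closedBall (0 : ℝ × ℝ)
  have hR' : ∀ p, η p ≠ 0 → |p.1| ≤ R ∧ |p.2| ≤ R := fun p hp => by
    have := hR (subset_tsupport _ hp)
    rw [mem_closedBall_zero_iff, Prod.norm_def] at this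
    exact ⟨(le_max_left _ _).trans this, (le_max_right _ _).trans this⟩
  -- Going back in time along a characteristic increases x, so the lower bound δ on the support of η
  -- persists for φ.
  obtain ⟨δ, hδ0, hδ⟩ := hc.isCompact.exists_forall_le' (f := fun p : ℝ × ℝ => p.2)
    continuous_snd.continuousOn (a := 0) fun p hp => (hs hp).2
  have hG : ContDiff ℝ 1 fun q : ℝ × ℝ => η (q.2, q.1 - q.2) :=
    hη.comp (contDiff_snd.prodMk (contDiff_fst.sub contDiff_snd))
  have hGR : ∀ ξ s, R < |s| → η (s, ξ - s) = 0 := fun ξ s hlt =>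
    by_contra fun hne => hlt.not_ge (hR' _ hne).1
  set E : ℝ × ℝ → ℝ := fun q => ∫ s in Ioi q.2, η (s, q.1 - s) with hE
  have hEs : ContDiff ℝ 1 E := contDiff_integral_Ioi (G := fun ξ s => η (s, ξ - s)) hG hGR
  -- Minus the integral of η over the future part of the characteristic. It need not vanish for t ≤
  -- 0; the cutoff is 1 for t ≥ 0 and 0 for t ≤ -1, giving compact support without altering the
  -- equation in the quadrant.
  set φ : ℝ × ℝ → ℝ := fun p => -(Real.smoothTransition (p.1 + 1) * E (p.1 + p.2, p.1)) with hφ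
  have hφs : ContDiff ℝ 1 φ := by
    refine ContDiff.neg (ContDiff.mul ?_ ?_)
    · exact (Real.smoothTransition.contDiff (n := 1)).comp (contDiff_fst.add contDiff_const)
    · exact hEs.comp ((contDiff_fst.add contDiff_snd).prodMk contDiff_fst)
  have hsupp : ∀ p, p ∉ Icc (-1) R ×ˢ Icc δ (2 * R + 1) → φ p = 0 := by
    rintro ⟨t, x⟩ hp
    by_contra hne
    have hχ : Real.smoothTransition (t + 1) ≠ 0 := fun h => hne (by simp [hφ, h])
    have hE0 : E (t + x, t) ≠ 0 := fun h => hne (by simp [hφ, h])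
    have ht : -1 < t := not_le.mp fun h =>
      hχ (Real.smoothTransition.zero_of_nonpos (by linarith))
    obtain ⟨s, hst, hηs⟩ : ∃ s, t < s ∧ η (s, t + x - s) ≠ 0 := by
      by_contra! hall
      exact hE0 (setIntegral_eq_zero_of_forall_eq_zero fun s hs' => hall s hs')
    have h1 := hR' _ hηs
    have h2 := hδ _ (subset_tsupport _ hηs)
    have h3 := abs_le.mp h1.1
    have h4 := abs_le.mp h1.2
    simp only at h2 h3 h4
    exact hp ⟨⟨ht.le, by linarith⟩, ⟨by linarith, by linarith⟩⟩
  have hK : IsCompact (Icc (-1 : ℝ) R ×ˢ Icc δ (2 * R + 1)) := isCompact_Icc.prod isCompact_Icc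
  refine ⟨φ, ⟨hφs, HasCompactSupport.intro hK hsupp, ?_⟩, ?_⟩
  · refine (closure_minimal (fun p hp => ?_) hK.isClosed).trans
      (fun p hp => lt_of_lt_of_le hδ0 hp.2.1)
    exact by_contra fun h => hp (hsupp p h)
  · rintro ⟨t, x⟩ ⟨ht, -⟩
    have hd := hasDerivAt_comp_shear (φ := φ) t (t + x) (hφs.differentiable one_ne_zero _)
    rw [add_sub_cancel_left] at hd
    have hgc : Continuous fun s => η (s, t + x - s) :=
      hη.continuous.comp (continuous_id.prodMk (continuous_const.sub continuous_id))
    have hgi : Integrable fun s => η (s, t + x - s) :=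
      hgc.integrable_of_hasCompactSupport <|
        HasCompactSupport.intro (isCompact_Icc (a := -R) (b := R))
          fun s hs' => hGR _ s (not_le.mp fun h => hs' (abs_le.mp h))
    have hd' := (hasDerivAt_integral_Ioi hgc hgi t).neg
    rw [neg_neg, add_sub_cancel_left] at hd'
    refine hd.unique (hd'.congr_of_eventuallyEq ?_)
    filter_upwards [lt_mem_nhds ht] with τ hτ
    simp only [hφ, hE, add_sub_cancel, Pi.neg_apply]
    rw [Real.smoothTransition.one_of_one_le (by linarith), one_mul]

/-- Source and datum terms coincide because β is the trace of u; they cancel on subtraction, and the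
trace of the mild function itself never enters. -/
theorem IsDistributionalSolution.ae_eq_mild {u₀ : ℝ → ℝ} (hu₀ : IsInitialDatum u₀)
    {u : ℝ × ℝ → ℝ} (hu : IsDistributionalSolution u₀ u) {β : ℝ → ℝ} (hβ : Measurable β)
    (hb : boundaryValue u =ᵐ[volume.restrict (Ioi 0)] β) :
    ∀ᵐ p : ℝ × ℝ, p ∈ Iquad → u p = mild ((Ici 0).indicator u₀) β (Phi p) := by
  have hf := hu₀.measurable_indicator
  have hfb := hu₀.locallyBounded_indicator
  have key := isOpen_Iquad.ae_eq_zero_of_integral_contDiff_smul_eq_zero (μ := volume)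
    (f := fun p => u p - mild ((Ici 0).indicator u₀) β (Phi p))
    (hu.locInt.sub (locallyIntegrableOn_mild_Phi hf hfb hβ)) ?_
  · filter_upwards [key] with p hp hpQ using sub_eq_zero.mp (hp hpQ)
  intro η hη hc hs
  obtain ⟨φ, hφ, hφη⟩ := exists_isTest_pd_sub_eq (hη.of_le (by exact_mod_cast le_top)) hc hs
  obtain ⟨hi, hw⟩ := hu.weak φ hφ
  have hi' := integrableOn_mild_mul hf hfb hβ hφ
  have hw' := mild_weak hf hfb hβ hφ
  rw [integral_strip_congr hb, integral_initial_congr, integral_neg] at hw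
  rw [integral_neg] at hw'
  rw [← setIntegral_eq_integral_of_forall_compl_eq_zero (s := Iquad) fun p hp => by
    rw [image_eq_zero_of_notMem_tsupport fun h => hp (hs h), zero_smul]]
  calc ∫ p in Iquad, η p • (u p - mild ((Ici 0).indicator u₀) β (Phi p))
      = ∫ p in Iquad, (u p * (pd₁ φ p - pd₂ φ p) -
          mild ((Ici 0).indicator u₀) β (Phi p) * (pd₁ φ p - pd₂ φ p)) := by
        refine setIntegral_congr_fun measurableSet_Iquad fun p hp => ?_
        simp only [smul_eq_mul, hφη p hp]
        ring
    _ = 0 := by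
        rw [integral_sub hi hi']
        linarith

/-! ### Approximate limits on every time slice -/

theorem volume_disc_ge (p : ℝ × ℝ) {r : ℝ} (hr : 0 < r) : r ^ 2 ≤ volume.real (disc p r) := by
  have hsub : Ioo (p.1 - r / 2) (p.1 + r / 2) ×ˢ Ioo (p.2 - r / 2) (p.2 + r / 2) ⊆ disc p r := by
    rintro q ⟨⟨h1, h2⟩, h3, h4⟩
    have e1 : (q.1 - p.1) ^ 2 < (r / 2) ^ 2 := sq_lt_sq' (by linarith) (by linarith)
    have e2 : (q.2 - p.2) ^ 2 < (r / 2) ^ 2 := sq_lt_sq' (by linarith) (by linarith)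
    simp only [disc, mem_ofPred_eq]
    nlinarith
  have hfin : volume (disc p r) ≠ ⊤ := by
    refine ((measure_mono ?_).trans_lt (isCompact_closedBall p r).measure_lt_top).ne
    intro q hq
    simp only [disc, mem_ofPred_eq] at hq
    rw [Metric.mem_closedBall, Prod.dist_eq, Real.dist_eq, Real.dist_eq]
    refine max_le ?_ ?_
    · exact abs_le_of_sq_le_sq (by nlinarith [sq_nonneg (q.2 - p.2)]) hr.le
    · exact abs_le_of_sq_le_sq (by nlinarith [sq_nonneg (q.1 - p.1)]) hr.le
  refine le_trans (le_of_eq ?_) (measureReal_mono hsub hfin)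
  rw [Measure.volume_eq_prod, measureReal_prod_prod, Real.volume_real_Ioo_of_le (by linarith),
    Real.volume_real_Ioo_of_le (by linarith)]
  ring

theorem disc_subset_preimage (t x : ℝ) {r : ℝ} (hr : 0 < r) :
    disc (t, x) r ⊆ Phi ⁻¹' (Ioo (t - r) (t + r) ×ˢ Metric.closedBall (t + x) (2 * r)) := by
  intro q hq
  simp only [disc, mem_ofPred_eq] at hq
  have h1 := abs_lt.mp (abs_lt_of_sq_lt_sq (a := q.1 - t) (b := r)
    (by nlinarith [sq_nonneg (q.2 - x)]) hr.le)
  have h2 := abs_lt.mp (abs_lt_of_sq_lt_sq (a := q.2 - x) (b := r)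
    (by nlinarith [sq_nonneg (q.1 - t)]) hr.le)
  refine ⟨⟨by simp [Phi]; linarith, by simp [Phi]; linarith⟩, ?_⟩
  rw [Metric.mem_closedBall, Real.dist_eq, abs_le]
  constructor <;> simp [Phi] <;> linarith

theorem measurableSet_disc (p : ℝ × ℝ) (r : ℝ) : MeasurableSet (disc p r) :=
  measurableSet_lt (by fun_prop) measurable_const

theorem locallyIntegrable_mild {f β : ℝ → ℝ} (hf : Measurable f) (hfb : LocallyBounded f)
    (hβ : Measurable β) (τ : ℝ) : LocallyIntegrable fun ξ => mild f β (τ, ξ) := by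
  rw [locallyIntegrable_iff]
  intro K hK
  obtain ⟨R, hR⟩ := hK.isBounded.subset_closedBall (0 : ℝ)
  obtain ⟨C, hC⟩ := hfb R
  refine IntegrableOn.of_bound hK.measure_lt_top ((measurable_mild hf hβ).comp
    (measurable_const.prodMk measurable_id)).aestronglyMeasurable (C + |τ|) ?_
  filter_upwards [ae_restrict_mem hK.measurableSet] with ξ hξ
  exact (abs_mild_le hβ _).trans
    (add_le_add_left (hC ξ (by simpa using mem_closedBall_zero_iff.mp (hR hξ))) _)

/-- On the disc, replacing the time of a point by t costs at most r. What remains depends only on ξ,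
and the sheared disc lies in a rectangle of width 2r in τ and 4r in ξ. The conditions r ≤ t and r ≤
x keep the disc inside the quadrant. -/
theorem average_disc_le {f β : ℝ → ℝ} (hf : Measurable f) (hfb : LocallyBounded f)
    (hβ : Measurable β) {u : ℝ × ℝ → ℝ}
    (hu : ∀ᵐ p : ℝ × ℝ, p ∈ Iquad → u p = mild f β (Phi p)) {t x r : ℝ} (hr : 0 < r)
    (hrt : r ≤ t) (hrx : r ≤ x) :
    ⨍ q in disc (t, x) r, |u q - mild f β (t, t + x)| ≤ 8 * r +
      8 * ⨍ y in Metric.closedBall (t + x) (2 * r), ‖mild f β (t, y) - mild f β (t, t + x)‖ := by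
  set l := mild f β (t, t + x) with hl
  set B := Metric.closedBall (t + x) (2 * r) with hB
  set S := Ioo (t - r) (t + r) ×ˢ B with hS
  have hBm : volume.real B = 4 * r := by
    rw [hB, Real.volume_real_closedBall (by linarith)]; ring
  have hSm : MeasurableSet S := measurableSet_Ioo.prod Metric.isClosed_closedBall.measurableSet
  have hrest : (volume : Measure (ℝ × ℝ)).restrict S =
      (volume.restrict (Ioo (t - r) (t + r))).prod (volume.restrict B) := by
    rw [Measure.prod_restrict]; rfl
  have hni : IntegrableOn (fun y => ‖mild f β (t, y) - l‖) B :=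
    (((locallyIntegrable_mild hf hfb hβ t).integrableOn_isCompact (isCompact_closedBall _ _)).sub
      (integrableOn_const (isCompact_closedBall _ _).measure_lt_top.ne)).norm
  have hci : IntegrableOn (fun _ : ℝ => r) B :=
    integrableOn_const (isCompact_closedBall _ _).measure_lt_top.ne
  have hHi : IntegrableOn (fun q : ℝ × ℝ => r + ‖mild f β (t, q.2) - l‖) S := by
    rw [IntegrableOn, hrest]
    exact (hci.add hni).comp_snd _
  have hHe : ∫ q in S, (r + ‖mild f β (t, q.2) - l‖) =
      2 * r * (4 * r * r + ∫ y in B, ‖mild f β (t, y) - l‖) := by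
    rw [hrest, integral_fun_snd (f := fun y => r + ‖mild f β (t, y) - l‖),
      integral_add hci hni, setIntegral_const, hBm, smul_eq_mul, smul_eq_mul,
      measureReal_restrict_apply_univ, Real.volume_real_Ioo_of_le (by linarith)]
    ring
  have hPi : IntegrableOn (fun q => r + ‖mild f β (t, (Phi q).2) - l‖) (Phi ⁻¹' S) :=
    (measurePreserving_Phi.integrableOn_comp_preimage measurableEmbedding_Phi
      (f := fun q : ℝ × ℝ => r + ‖mild f β (t, q.2) - l‖)).mpr hHi
  have hPe := measurePreserving_Phi.setIntegral_preimage_emb measurableEmbedding_Phi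
    (fun q : ℝ × ℝ => r + ‖mild f β (t, q.2) - l‖) S
  have hsub := disc_subset_preimage t x hr
  have hle : ∫ q in disc (t, x) r, |u q - l| ≤
      2 * r * (4 * r * r + ∫ y in B, ‖mild f β (t, y) - l‖) := by
    rw [← hHe, ← hPe]
    refine le_trans ?_ (setIntegral_mono_set hPi (ae_of_all _ fun q => by positivity)
      hsub.eventuallyLE)
    refine integral_mono_of_nonneg (ae_of_all _ fun q => abs_nonneg _)
      (hPi.mono_set hsub) ?_
    filter_upwards [ae_restrict_of_ae hu, ae_restrict_mem (measurableSet_disc (t, x) r)]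
      with q hq hqd
    obtain ⟨⟨h1, h2⟩, -⟩ := hsub hqd
    simp only [Phi] at h1 h2
    have hx : |q.2 - x| < r := by
      simp only [disc, mem_ofPred_eq] at hqd
      exact abs_lt_of_sq_lt_sq (by nlinarith [sq_nonneg (q.1 - t)]) hr.le
    rw [hq ⟨by linarith, by linarith [(abs_lt.mp hx).1]⟩]
    refine (abs_sub_le _ (mild f β (t, (Phi q).2)) _).trans (add_le_add ?_ le_rfl)
    exact (abs_mild_sub_mild_le hβ t q.1 _).trans
      (abs_le.mpr ⟨by linarith, by linarith⟩)
  have hI : 0 ≤ ∫ y in B, ‖mild f β (t, y) - l‖ := integral_nonneg fun _ => norm_nonneg _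
  rw [setAverage_eq, setAverage_eq, hBm, smul_eq_mul, smul_eq_mul]
  calc (volume.real (disc (t, x) r))⁻¹ * ∫ q in disc (t, x) r, |u q - l|
      ≤ (r ^ 2)⁻¹ * (2 * r * (4 * r * r + ∫ y in B, ‖mild f β (t, y) - l‖)) := by
        refine mul_le_mul ?_ hle (integral_nonneg fun _ => abs_nonneg _) (by positivity)
        exact inv_anti₀ (by positivity) (volume_disc_ge _ hr)
    -- The rectangle sides 2r and 4r are weighed against the lower bound r² for the area of the
    -- disc.
    _ = 8 * r + 8 * ((4 * r)⁻¹ * ∫ y in B, ‖mild f β (t, y) - l‖) := by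
        field_simp
        ring

/-- One-dimensional Lebesgue differentiation at the fixed time τ; the exceptional null set lives in
ξ alone, so no τ is lost. -/
theorem ae_hasApproxLimit {f β : ℝ → ℝ} (hf : Measurable f) (hfb : LocallyBounded f)
    (hβ : Measurable β) {u : ℝ × ℝ → ℝ}
    (hu : ∀ᵐ p : ℝ × ℝ, p ∈ Iquad → u p = mild f β (Phi p)) {τ : ℝ} (hτ : 0 < τ) :
    ∀ᵐ ξ : ℝ, τ < ξ → HasApproxLimit u (PhiInv (τ, ξ)) (mild f β (τ, ξ)) := by
  filter_upwards [IsUnifLocDoublingMeasure.ae_tendsto_average_norm_sub volume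
    (locallyIntegrable_mild hf hfb hβ τ) 1] with ξ hξ hτξ
  have h2r : Tendsto (fun r : ℝ => 2 * r) (𝓝[>] 0) (𝓝[>] 0) := by
    refine tendsto_nhdsWithin_iff.mpr ⟨?_, ?_⟩
    · have : Tendsto (fun r : ℝ => 2 * r) (𝓝 0) (𝓝 (2 * 0)) := tendsto_id.const_mul 2
      rw [mul_zero] at this
      exact this.mono_left nhdsWithin_le_nhds
    · filter_upwards [self_mem_nhdsWithin] with r hr
      simpa using hr
  have hlim := hξ (fun _ => ξ) (fun r : ℝ => 2 * r) h2r (by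
    filter_upwards [self_mem_nhdsWithin] with r hr
    have : (0 : ℝ) < r := hr
    exact Metric.mem_closedBall_self (by positivity))
  have hid : Tendsto (fun r : ℝ => r) (𝓝[>] 0) (𝓝 0) := tendsto_id.mono_left nhdsWithin_le_nhds
  have hsum := (hid.const_mul 8).add (hlim.const_mul 8)
  rw [mul_zero, add_zero] at hsum
  refine squeeze_zero' (Eventually.of_forall fun r => ?_) ?_ hsum
  · rw [setAverage_eq]
    exact smul_nonneg (by positivity) (integral_nonneg fun _ => abs_nonneg _)
  · filter_upwards [self_mem_nhdsWithin,
      (gt_mem_nhds hτ).filter_mono nhdsWithin_le_nhds,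
      (gt_mem_nhds (sub_pos.mpr hτξ)).filter_mono nhdsWithin_le_nhds] with r hr hrt hrx
    have := average_disc_le hf hfb hβ hu hr hrt.le hrx.le
    rwa [add_sub_cancel] at this

end Mancala

/-! ### The proposition -/

theorem mainTheorem7 (u₀ : ℝ → ℝ) (hu₀ : Mancala.IsInitialDatum u₀) :
    -- integral solutions are distributional solutions
    (∀ v : ℝ × ℝ → ℝ, Mancala.IsIntegralSolution u₀ v →
      Mancala.IsDistributionalSolution u₀ (fun p => v (Mancala.Phi p))) ∧
    -- locally bounded distributional solutions in BV_loc satisfy the integral equation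
    (∀ u : ℝ × ℝ → ℝ, Mancala.IsDistributionalSolution u₀ u →
      Mancala.IsBVLoc u Mancala.Iquad → Mancala.LocBoundedOn u Mancala.Iquad →
      ∀ v : ℝ × ℝ → ℝ, (∀ p ∈ Mancala.IIoct, v p = u (Mancala.PhiInv p)) →
        Mancala.HasDiagLimits v ∧
        -- the given function satisfies the equation almost everywhere
        (∀ᵐ p : ℝ × ℝ, p ∈ Mancala.IIoct → v p = Mancala.integralRHS u₀ v p) ∧
        -- its precise representative satisfies it for every τ and almost every ξ
        (∀ τ : ℝ, 0 < τ → ∀ᵐ ξ : ℝ, τ < ξ →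
          Mancala.HasApproxLimit u (Mancala.PhiInv (τ, ξ)) (Mancala.integralRHS u₀ v (τ, ξ))) ∧
        -- hence so does the given function if it is precisely represented
        (∀ τ : ℝ, 0 < τ → (∀ᵐ x : ℝ, 0 < x → Mancala.IsPreciseAt u (τ, x)) →
          ∀ᵐ ξ : ℝ, τ < ξ → v (τ, ξ) = Mancala.integralRHS u₀ v (τ, ξ))) := by
  open Mancala in
  refine ⟨fun v hv => hv.isDistributionalSolution hu₀, fun u hu _ _ v hv => ?_⟩
  have hdl : ∀ τ, 0 < τ → ∀ l, Tendsto (fun x => u (τ, x)) (𝓝[>] (0 : ℝ)) (𝓝 l) →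
      Tendsto (fun ξ => v (τ, ξ)) (𝓝[>] τ) (𝓝 l) := by
    intro τ hτ l hl
    refine (hl.comp (tendsto_sub_const_nhdsGT τ)).congr' ?_
    filter_upwards [self_mem_nhdsWithin] with ξ hξ
    exact (hv (τ, ξ) ⟨hτ, hξ⟩).symm
  obtain ⟨β, hβ, hb⟩ := exists_measurable_boundaryValue (u := u)
    hu.locInt.aestronglyMeasurable.aemeasurable hu.boundary
  have hdiag : diagValue v =ᵐ[volume.restrict (Ioi 0)] β := by
    filter_upwards [hb, ae_restrict_mem measurableSet_Ioi] with t ht ht0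
    rw [← ht]
    obtain ⟨l, -, hl⟩ := hu.boundary t ht0
    exact (hdl t ht0 l hl).limUnder_eq.trans hl.limUnder_eq.symm
  have hrhs : ∀ p ∈ IIoct, integralRHS u₀ v p = mild ((Ici 0).indicator u₀) β p := by
    intro p hp
    rw [integralRHS_eq_mild]
    refine mild_congr ?_ hdiag hp.1
    rw [indicator_of_mem]
    exact (hp.1.trans hp.2).le
  have hae := hu.ae_eq_mild hu₀ hβ hb
  have happrox : ∀ τ : ℝ, 0 < τ → ∀ᵐ ξ : ℝ, τ < ξ →
      HasApproxLimit u (PhiInv (τ, ξ)) (integralRHS u₀ v (τ, ξ)) := by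
    intro τ hτ
    filter_upwards [ae_hasApproxLimit hu₀.measurable_indicator hu₀.locallyBounded_indicator
      hβ hae hτ] with ξ hξ hτξ
    rw [hrhs _ ⟨hτ, hτξ⟩]
    exact hξ hτξ
  refine ⟨fun τ hτ => ?_, ?_, happrox, fun τ hτ hprec => ?_⟩
  · obtain ⟨l, hl0, hl⟩ := hu.boundary τ hτ
    exact ⟨l, hl0, hdl τ hτ l hl⟩
  · rw [← measurePreserving_Phi.map_eq, measurableEmbedding_Phi.ae_map_iff]
    filter_upwards [hae] with p hp hpII
    rw [hrhs _ hpII, hv _ hpII, PhiInv_Phi]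
    exact hp (by rwa [← preimage_Phi_IIoct])
  -- The translation ξ ↦ ξ - τ turns the condition for almost every x into one for almost every ξ.
  · have hshift := (measurePreserving_sub_right (volume : Measure ℝ) τ).quasiMeasurePreserving.ae
      hprec
    filter_upwards [happrox τ hτ, hshift] with ξ hξ hpr hτξ
    rw [hv _ ⟨hτ, hτξ⟩]
    exact hpr (sub_pos.mpr hτξ) _ (hξ hτξ)
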